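/- **Setting.** Let $K$ be the field with $q$ elements, let $G$ be the additive group of the field with $q^m$ elements, and let $\alpha$ be a generator of $G^*=G\setminus\{0\}$. Let $n=q^m-1=r_1r_2$ with $\gcd(r_1,r_2)=1$ and $r_1,r_2>1$, and let $\varphi:\mathbb Z_n\to\mathbb Z_{r_1}\times\mathbb Z_{r_2}$ be any group isomorphism. Words are the elements $x=\sum_{g\in G}x_gX^g$ of the group algebra $KG$, and $\omega$ is the Hamming weight. A permutation $\tau$ of $G$ acts by $\tau(x)=\sum_g x_gX^{\tau(g)}$. Let $\mathcal C=R_q(1,m)\subseteq KG$ be the first-order Generalized Reed–Muller code. It consists of all $x$ with $\sum_{g}x_gg^i=0$ (where $0^0=1$) for every $0\le i<q^m-1$ whose sum of base-$q$ digits is less than $m(q-1)-1$. Let $d$ be its minimum distance and $t=\lfloor (d-1)/2\rfloor$. Let $\mathcal C^*$ be the code obtained by deleting position $0$. Let $\mathrm{PAut}(\mathcal C^*)$ be the group of permutations of $G^*$ preserving $\mathcal C^*$; its elements are extended to $G$ by fixing $0$. An *information set* of $\mathcal C$ is a set $I\subseteq G$ with $|I|=\dim\mathcal C$ such that $\mathcal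 C$ projects onto $K^I$; write $I'=I\setminus\{0\}$. A set $P\subseteq \mathrm{PAut}(\mathcal C^*)$ is an *$s$-PD-like set* with respect to $I'$ if for any $s$ positions in $G^*$ some $\tau\in P$ moves all of them out of $I'$. **Algorithm I.** The input is an information set $I$, a parity check matrix $H$ of $\mathcal C$ in standard form with respect to $I$ (the columns at positions outside $I$ form the identity), a finite $s$-PD-like set $P$ with respect to $I'$ with $s\le t$, and a received word $r$. Let $\sigma$ run through the identity followed by the translations $X^g\mapsto X^{g+\alpha^k}$, $k=0,\dots,n-1$. For each $\sigma$, let $\tau$ run through $P$ (in any order). Stop at the first pair with $\omega(H\cdot\tau(\sigma(r))^T)\le t$. Let $c'\in\mathcal C$ be the codeword agreeing with $\tau(\sigma(r))$ on $I$, and output $(\tau\circ\sigma)^{-1}(c')$. The algorithm *corrects up to $s$ errors* if it outputs $c$ on $r=c+e$ for all $c\in\mathcal C$ and all $e\in KG$ with $\omega(e)\le s$. **Theorem.** The code $\mathcal C$ is affine-invariant: it is an ideal of $KG$ whose words have coefficient sum $0$, and it is preserved by all permutations $x\mapsto ax+b$ of $G$ ($a\in G^*$, $b\in G$). Moreover,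 the set of all $0\le i\le q^m-1$ with $\sum_g x_gg^i=0$ for every $x\in\mathcal C$ is exactly the set of exponents used to define $\mathcal C$. The order of $q$ modulo $r_1$ or modulo $r_2$ equals $m$. Interchanging $r_1$ and $r_2$ if necessary, suppose $\mathrm{Ord}_{r_1}(q)=m$. Then: 1. The set $I=\{0\}\cup\{\alpha^i\mid \varphi(i)\in\Gamma\}$, where $\Gamma=\{(i_1,i_2)\in\mathbb Z_{r_1}\times\mathbb Z_{r_2}\mid 0\le i_1<m,\ 0\le i_2<1\}$, is an information set for $\mathcal C$, and $\mathcal C$ has a parity check matrix in standard form with respect to $I$. 2. The maximum $\lambda_0=\max\{\lambda\ge 1\mid m<\lceil r_1/\lambda\rceil\}$ exists. 3. Put $s=(\lambda_0+1)r_2-1$. The group generated by the permutation $g\mapsto\alpha g$ of $G^*$ is an $s$-PD-like set with respect to $I'$, and also a $\min\{s,t\}$-PD-like set. 4. Algorithm I with the information set $I$ corrects up to $s$ errors, within the error correction capability $t$ of the code. That is, used with any $\min\{s,t\}$-PD-like set with respect to $I'$ (in particular with the group in 3), it corrects up to $\min\{s,t\}$ errors. -/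

import Mathlib

namespace GRM

noncomputable section

open scoped Classical

/-! ### The ambient group algebra

`K` is the field with `q` elements and `L` its extension with `q ^ m` elements; the group `G` is the
additive group of `L`, and words are the elements `∑ a_g X^g` of the group algebra of `G` over `K`.
The coefficient `a_g` of the word `x` is `x.coeff g`. -/

/-- The group algebra `K G`. -/
abbrev Word (K L : Type*) [Field K] [Field L] := AddMonoidAlgebra K L

/-- The set of nonzero positions `G^*`. -/
abbrev GStar (L : Type*) [Field L] := {g : L // g ≠ 0}

section Codes

variable {K L : Type*} [Field K] [Field L] [Fintype L] [Algebra K L]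

/-- A permutation `τ` of the positions sends `∑ a_g X^g` to `∑ a_g X^(τ g)`. -/
def act (τ : Equiv.Perm L) (x : Word K L) : Word K L := x.mapDomain τ

/-- Hamming weight of a word. -/
def weight (x : Word K L) : ℕ := hammingNorm (fun g : L => x.coeff g)

/-- Minimum distance of a code. -/
def minDist (C : Submodule K (Word K L)) : ℕ :=
  sInf {d | ∃ x ∈ C, ∃ y ∈ C, x ≠ y ∧ d = hammingDist (fun g : L => x.coeff g) fun g => y.coeff g}

/-- Error correction capability `t = ⌊(d - 1) / 2⌋`. -/
def capability (C : Submodule K (Word K L)) : ℕ := (minDist C - 1) / 2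

/-- The permutation automorphisms of `C`. -/
def PAut (C : Submodule K (Word K L)) : Set (Equiv.Perm L) :=
  {τ | act τ '' (C : Set (Word K L)) = C}

/-- The affine permutation `x ↦ a x + b` of `G`, for `a ≠ 0`. -/
def affinePerm (a : Lˣ) (b : L) : Equiv.Perm L := (Units.mulLeft a).trans (Equiv.addRight b)

/-- Extended cyclic codes (with respect to the generator `α` of `G^*`): ideals of `K G` that are
closed under the shift `X^0 ↦ X^0, X^(α^i) ↦ X^(α^(i+1))` and whose words have coefficient sum
zero. -/
structure IsExtendedCyclic (α : Lˣ) (C : Submodule K (Word K L)) : Prop where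
  ideal : ∀ x : Word K L, ∀ c ∈ C, x * c ∈ C
  shift : ∀ c ∈ C, act (affinePerm α 0) c ∈ C
  sum_eq_zero : ∀ c ∈ C, ∑ g : L, c.coeff g = 0

/-- Affine-invariant codes. -/
structure IsAffineInvariant (α : Lˣ) (C : Submodule K (Word K L)) : Prop where
  extendedCyclic : IsExtendedCyclic α C
  affine : ∀ (a : Lˣ) (b : L), affinePerm a b ∈ PAut C

/-- The map `φ_s (∑ a_g X^g) = ∑ a_g g^s`, with `0^0 = 1`. -/
def phi (s : ℕ) : Word K L →ₗ[K] L where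
  toFun x := ∑ g : L, x.coeff g • g ^ s
  map_add' x y := by simp [add_smul, Finset.sum_add_distrib]
  map_smul' c x := by simp [mul_smul, Finset.smul_sum]

/-- The defining set of a code, as a subset of `{0, …, q^m - 1}`. -/
def definingSet (C : Submodule K (Word K L)) : Set ℕ :=
  {s | s ≤ Fintype.card L - 1 ∧ ∀ x ∈ C, phi s x = 0}

/-- The `q`-weight of `k`: the sum of its digits in base `q`. -/
def qWeight (q k : ℕ) : ℕ := (Nat.digits q k).sum

/-- `{0 ≤ i < q^m - 1 | wt_q(i) < m (q - 1) - ρ}`. -/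
def grmDefiningSet (q m ρ : ℕ) : Set ℕ :=
  {i | i < q ^ m - 1 ∧ qWeight q i < m * (q - 1) - ρ}

variable (K L) in
/-- The Generalized Reed-Muller code `R_q(ρ, m)`: the code in `K G` cut out by the defining set
`grmDefiningSet q m ρ`. -/
def grmCode (q m ρ : ℕ) : Submodule K (Word K L) :=
  ⨅ i ∈ grmDefiningSet q m ρ, LinearMap.ker (phi (K := K) (L := L) i)

/-! ### Punctured code and PD-like sets -/

/-- Deleting the position `X^0`. -/
def puncture : Word K L →ₗ[K] (GStar L → K) where
  toFun x := fun g => x.coeff g.1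
  map_add' x y := by ext; simp
  map_smul' c x := by ext; simp

/-- The punctured code `C^*`. -/
def punctured (C : Submodule K (Word K L)) : Submodule K (GStar L → K) := C.map puncture

/-- The permutation automorphisms of `C^*`; here `τ` moves the entry at `g` to `τ g`. -/
def PAutStar (C : Submodule K (Word K L)) : Set (Equiv.Perm (GStar L)) :=
  {τ | (fun v : GStar L → K => v ∘ τ.symm) '' (punctured C : Set (GStar L → K)) = punctured C}

/-- A permutation of `G^*`, regarded as the permutation of `G` that fixes `0`. -/
def extend (τ : Equiv.Perm (GStar L)) : Equiv.Perm L := Equiv.Perm.ofSubtype τ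

/-- The set `I' = I \ {0}`, as a set of positions in `G^*`. -/
def prime (I : Set L) : Set (GStar L) := {g | g.1 ∈ I}

/-- `P ⊆ PAut(C^*)` is an `s`-PD-like set for `C^*` with respect to `J`: any `s` positions in `G^*`
are moved out of `J` by some element of `P`. -/
def IsPDLikeSet (C : Submodule K (Word K L)) (J : Set (GStar L)) (s : ℕ)
    (P : Set (Equiv.Perm (GStar L))) : Prop :=
  P ⊆ PAutStar C ∧ ∀ B : Finset (GStar L), B.card = s → ∃ τ ∈ P, ∀ b ∈ B, τ b ∉ J

/-- The permutation `T_α : X^(α^i) ↦ X^(α^(i+1))` of `G^*`. -/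
def T (α : Lˣ) : Equiv.Perm (GStar L) where
  toFun g := ⟨α * g.1, mul_ne_zero α.ne_zero g.2⟩
  invFun g := ⟨↑α⁻¹ * g.1, mul_ne_zero α⁻¹.ne_zero g.2⟩
  left_inv g := by ext; simp
  right_inv g := by ext; simp

/-! ### Information sets and parity check matrices -/

/-- `I` is an information set for `C`: `|I| = dim C`, and `C` projects onto `K^I`. -/
def IsInformationSet (C : Submodule K (Word K L)) (I : Set L) : Prop :=
  I.ncard = Module.finrank K C ∧ ∀ y : I → K, ∃ c ∈ C, ∀ i : I, c.coeff i.1 = y i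

/-- `I = {0} ∪ {α^i | φ(i) ∈ Γ}` with `Γ = {(i₁, i₂) | 0 ≤ i₁ < m, 0 ≤ i₂ < 1}`. -/
def infoSet (m : ℕ) {n r₁ r₂ : ℕ} (α : Lˣ) (φ : ZMod n ≃+ ZMod r₁ × ZMod r₂) : Set L :=
  {0} ∪ {x | ∃ i : ZMod n, (φ i).1.val < m ∧ (φ i).2.val < 1 ∧ x = (α : L) ^ i.val}

/-- The column vector `H x^T`. -/
def syndrome {I : Set L} (H : Matrix {g : L // g ∉ I} L K) (x : Word K L) :
    {g : L // g ∉ I} → K := H.mulVec fun g => x.coeff g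

/-- `H` is a parity check matrix of `C` in standard form with respect to `I`: its rows are indexed
by the positions outside `I`, and its columns outside `I` form the identity matrix. -/
def IsStandardParityCheck (C : Submodule K (Word K L)) (I : Set L)
    (H : Matrix {g : L // g ∉ I} L K) : Prop :=
  (∀ x : Word K L, x ∈ C ↔ syndrome H x = 0) ∧
    ∀ i j : {g : L // g ∉ I}, H i j.1 = if i = j then 1 else 0

/-! ### Algorithm I -/

/-- The codeword with the same information symbols as `v`: the symbols at the positions of `I` are
copied, the check symbols are computed from them with `H` (which is in standard form). -/
def reencode {I : Set L} (H : Matrix {g : L // g ∉ I} L K) (v : Word K L) : Word K L :=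
  AddMonoidAlgebra.ofCoeff <| Finsupp.equivFunOnFinite.symm fun g =>
    if h : g ∉ I then -∑ i : I, H ⟨g, h⟩ i.1 * v.coeff i.1 else v.coeff g

/-- The sequence of translations `(1, σ_0, …, σ_(n-1))`, where `σ_k (X^g) = X^(g + α^k)`. -/
def translations (n : ℕ) (α : Lˣ) : List (Equiv.Perm L) :=
  1 :: (List.range n).map fun k => Equiv.addRight ((α : L) ^ k)

/-- The modified permutation decoding algorithm on the received word `r`. The translations `σ` are
tried one after the other; for each of them the elements `τ` of the PD-like set, listed in `P`, are
applied to `σ r` one after the other. At the first pair for which `H (τ (σ r))^T` has weight at most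
`t`, the codeword with the information symbols of `τ (σ r)` is computed, and its image under
the inverse of `τ ∘ σ` is returned. If there is no such pair, the algorithm fails (`none`). -/
def algorithmI (n : ℕ) (α : Lˣ) {I : Set L} (H : Matrix {g : L // g ∉ I} L K)
    (P : List (Equiv.Perm (GStar L))) (t : ℕ) (r : Word K L) : Option (Word K L) :=
  (translations n α).findSome? fun σ =>
    (P.find? fun τ => decide (hammingNorm (syndrome H (act (extend τ) (act σ r))) ≤ t)).map
      fun τ => act (extend τ * σ)⁻¹ (reencode H (act (extend τ) (act σ r)))

/-- The decoder `A` corrects up to `s` errors in the words of `C`. -/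
def CorrectsUpTo (C : Submodule K (Word K L)) (s : ℕ) (A : Word K L → Option (Word K L)) : Prop :=
  ∀ c ∈ C, ∀ e : Word K L, weight e ≤ s → A (c + e) = some c

end Codes

end

end GRM

/-!
The code `R_q(1, m)` consists of the words `∑ (b + f g) X^g` with `b ∈ K` and `f : L → K` a
`K`-linear form (`GRM.mem_grmCode_one_iff`), and everything else is read off from this description.
By a digit count (`GRM.mem_grmDefiningSet_one_iff`), the exponents in `{0, …, q^m - 1}` missing from
the defining set are `q^m - 1` and the `q^m - 1 - q^k` with `k < m`. Every linear form is
`g ↦ Tr(a g) = ∑ (a g)^(q^k)`, so the power sums of `L` show that the words of affine functions lie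
in the code, and also that no further exponent belongs to its defining set. Conversely, the
functionals `phi` at the exponents `q^m - 1 - q^k` are Frobenius conjugates of each other, so a word
of the code is determined by its coefficient at `0` and one more element of `L`
(`GRM.eq_zero_of_mem_grmCode`); an affine function with the same data exists. Affine permutations
map affine functions to affine functions, hence the affine invariance.

If both orders of `q` were proper divisors `a`, `b` of `m`, then `r₁ r₂ ≤ (q^a - 1)(q^b - 1)`, which
is less than `q^m - 1`. Suppose that the order modulo `r₁` is `m`. The nonzero positions of the
information set are the powers `β^j`, `j < m`, of an element `β` of order `r₁`. The field `K(β)` has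
degree `m`, so these powers form a basis of `L` over `K` (`GRM.exists_basis_rowGenerator`), and an
affine function can take any values at `0` and on a basis, and is determined by them.

For the PD-like property, fewer than `(λ₀ + 1) r₂` positions leave some row of `ℤ_{r₁} × ℤ_{r₂}`
with at most `λ₀` of them. In this row each position rules out `m` cyclic shifts, and
`m λ₀ < r₁`, so some shift moves all positions out of `Γ` (`GRM.exists_shift_avoiding_infoSet`).

The algorithm is correct for every code that is translation invariant and has coefficient sums zero
(`GRM.correctsUpTo_algorithmI`). Some translation makes the position `0` free of errors, and then
the PD-like set moves the errors out of the information set, so that the syndrome has small weight.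
Wherever the algorithm stops, the weight of the syndrome is the distance from the permuted received
word to the reencoded codeword. The permuted transmitted codeword is at distance at most `t` from
the same word, so the two codewords agree because the minimum distance exceeds `2 t`.
-/

namespace GRM

noncomputable section

open scoped Classical

open Finset

/-! ### Digit sums -/

lemma qWeight_add_mul {q d : ℕ} (hq : 1 < q) (hd : d < q) (a : ℕ) :
    qWeight q (d + q * a) = d + qWeight q a := by
  unfold qWeight
  by_cases h : d ≠ 0 ∨ a ≠ 0
  · rw [Nat.digits_add q hq d a hd h, List.sum_cons]
  · push Not at h
    simp [h.1, h.2]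

/-- Subtracting from `q ^ m - 1` replaces each of the `m` digits `d` by `q - 1 - d`. -/
lemma qWeight_sub_one_sub {q : ℕ} (hq : 1 < q) (m : ℕ) {i : ℕ} (hi : i < q ^ m) :
    qWeight q i + qWeight q (q ^ m - 1 - i) = m * (q - 1) := by
  induction m generalizing i with
  | zero =>
    obtain rfl : i = 0 := by simpa using hi
    simp [qWeight]
  | succ m ih =>
    have ha : i / q < q ^ m := Nat.div_lt_of_lt_mul (by rwa [← pow_succ'])
    have hd : i % q < q := Nat.mod_lt _ (by omega)
    have hi' := Nat.mod_add_div i q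
    have h1 : q ^ (m + 1) - 1 - i = (q - 1 - i % q) + q * (q ^ m - 1 - i / q) := by
      obtain ⟨b, hb⟩ := Nat.exists_eq_add_of_lt ha
      rw [show q ^ m - 1 - i / q = b by omega, pow_succ', hb, mul_add, mul_add, mul_one]
      omega
    have h2 : qWeight q i = i % q + qWeight q (i / q) := by
      conv_lhs => rw [← hi']
      exact qWeight_add_mul hq hd _
    rw [h1, h2, qWeight_add_mul hq (by omega)]
    have := ih ha
    rw [add_mul, one_mul, ← this]
    omega

lemma qWeight_pow {q : ℕ} (hq : 1 < q) (k : ℕ) : qWeight q (q ^ k) = 1 := by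
  induction k with
  | zero =>
    have := qWeight_add_mul hq hq 0
    simpa [qWeight] using this
  | succ k ih =>
    have := qWeight_add_mul (d := 0) hq (by omega) (q ^ k)
    rw [zero_add, zero_add, ← pow_succ'] at this
    rw [this, ih]

lemma qWeight_eq_zero {q k : ℕ} (h : qWeight q k = 0) : k = 0 := by
  by_contra hk
  have h1 := Nat.getLast_digit_ne_zero q hk
  exact h1 (List.sum_eq_zero_iff.mp h _ (List.getLast_mem _))

lemma exists_eq_pow_of_qWeight_eq_one {q : ℕ} (hq : 1 < q) (i : ℕ) (h : qWeight q i = 1) :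
    ∃ k, i = q ^ k := by
  induction i using Nat.strong_induction_on with
  | _ i ih =>
    have hd : i % q < q := Nat.mod_lt _ (by omega)
    have hi' := Nat.mod_add_div i q
    have h2 : qWeight q i = i % q + qWeight q (i / q) := by
      conv_lhs => rw [← hi']
      exact qWeight_add_mul hq hd _
    rcases Nat.eq_zero_or_pos (i % q) with h0 | h0
    · have hi0 : i ≠ 0 := by rintro rfl; simp [qWeight] at h
      obtain ⟨k, hk⟩ := ih (i / q) (Nat.div_lt_self (by omega) hq) (by omega)
      exact ⟨k + 1, by rw [pow_succ', ← hk]; omega⟩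
    · have := qWeight_eq_zero (q := q) (k := i / q) (by omega)
      exact ⟨0, by rw [this] at hi'; simp at hi' ⊢; omega⟩

/-- Up to `q ^ m - 1`, the exponents outside the defining set of the first-order code are
`q ^ m - 1` and the numbers `q ^ m - 1 - q ^ k`. -/
lemma mem_grmDefiningSet_one_iff {q m i : ℕ} (hq : 1 < q) (hm : 0 < m) (hi : i ≤ q ^ m - 1) :
    i ∈ grmDefiningSet q m 1 ↔ i ≠ q ^ m - 1 ∧ ∀ k < m, i ≠ q ^ m - 1 - q ^ k := by
  have hpos : 0 < q ^ m := by positivity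
  have hsum := qWeight_sub_one_sub hq m (i := i) (by omega)
  have h1 : 1 ≤ m * (q - 1) := Nat.mul_pos hm (by omega)
  have hlt : ∀ k < m, q ^ k ≤ q ^ m - 1 := fun k hk =>
    Nat.le_sub_one_of_lt (Nat.pow_lt_pow_right hq hk)
  constructor
  · rintro ⟨h, hw⟩
    refine ⟨h.ne, fun k hk hik => ?_⟩
    have := hlt k hk
    rw [show q ^ m - 1 - i = q ^ k by omega, qWeight_pow hq] at hsum
    omega
  · rintro ⟨h, hk⟩
    refine ⟨by omega, ?_⟩
    by_contra hw
    have hle : qWeight q (q ^ m - 1 - i) ≤ 1 := by omega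
    rcases Nat.le_one_iff_eq_zero_or_eq_one.mp hle with h0 | h0
    · have := qWeight_eq_zero h0
      omega
    · obtain ⟨k, hk'⟩ := exists_eq_pow_of_qWeight_eq_one hq _ h0
      refine hk k ((Nat.pow_lt_pow_iff_right hq).mp ?_) ?_ <;> omega

/-- The condition `2 < q ^ m` excludes the degenerate case `m (q - 1) = 1`, in which the defining
set is empty. -/
lemma zero_mem_grmDefiningSet {q m : ℕ} (hq : 1 < q) (h6 : 2 < q ^ m) :
    0 ∈ grmDefiningSet q m 1 := by
  have hm : 0 < m := Nat.pos_of_ne_zero (by rintro rfl; simp at h6)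
  rw [mem_grmDefiningSet_one_iff hq hm (Nat.zero_le _)]
  refine ⟨by omega, fun k hk h0 => ?_⟩
  have h1 : q ^ k * q ≤ q ^ m := by rw [← pow_succ]; exact Nat.pow_le_pow_right (by omega) hk
  rcases Nat.lt_or_ge (q ^ k) 2 with h2 | h2
  · omega
  · have := Nat.mul_le_mul_left (q ^ k) hq
    omega

lemma pow_lt_sub_one {q m k : ℕ} (hq : 1 < q) (h6 : 2 < q ^ m) (hk : k < m) :
    q ^ k < q ^ m - 1 := by
  have := ((mem_grmDefiningSet_one_iff hq (by omega) (Nat.zero_le _)).mp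
    (zero_mem_grmDefiningSet hq h6)).2 k hk
  omega

/-! ### Power sums over a finite field -/

section PowerSums

variable {K L : Type*} [Field K] [Field L] [Fintype L] [Algebra K L]

lemma sum_pow_eq_ite (e : ℕ) :
    ∑ g : L, g ^ e = if 0 < e ∧ Fintype.card L - 1 ∣ e then -1 else 0 := by
  rcases Nat.eq_zero_or_pos e with rfl | he
  · simp
  · have h0 : ∑ g : L, g ^ e = ∑ g : Lˣ, (g : L) ^ e := by
      rw [← Finset.sum_erase_add _ _ (mem_univ (0 : L)), zero_pow he.ne', add_zero]
      refine (Finset.sum_nbij' (fun g : Lˣ => (g : L))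
        (fun g => if h : g ≠ 0 then Units.mk0 g h else 1) ?_ ?_ ?_ ?_ ?_).symm
      · intro g _; simp
      · intro g _; simp
      · intro g _; simp
      · intro g hg
        have : g ≠ 0 := by simpa using hg
        simp [this]
      · intro g _; rfl
    have h1 := FiniteField.sum_pow_units L e
    rw [h0, h1]
    simp [he]

lemma phi_apply (s : ℕ) (x : Word K L) : phi s x = ∑ g : L, x.coeff g • g ^ s := rfl

/-- The sum of the values of a polynomial, weighted by the coefficients of a word, is a combination
of the `phi k` with `k` up to its degree. -/
lemma sum_smul_eval (x : Word K L) (p : Polynomial L) :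
    ∑ g : L, x.coeff g • p.eval g = ∑ k ∈ range (p.natDegree + 1), p.coeff k * phi k x := by
  simp_rw [Polynomial.eval_eq_sum_range, phi_apply, Finset.smul_sum, Finset.mul_sum]
  rw [Finset.sum_comm]
  simp_rw [mul_smul_comm]

lemma eq_zero_of_forall_phi_eq_zero (x : Word K L)
    (h : ∀ i ≤ Fintype.card L - 1, phi i x = 0) : x = 0 := by
  have hc : 1 < Fintype.card L := Fintype.one_lt_card
  ext g
  -- `1 - (X - g) ^ (|L| - 1)` is the indicator function of `g`
  have key := sum_smul_eval x (1 - (Polynomial.X - Polynomial.C g) ^ (Fintype.card L - 1))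
  have hdeg : (1 - (Polynomial.X - Polynomial.C g) ^ (Fintype.card L - 1)).natDegree ≤
      Fintype.card L - 1 := by
    refine (Polynomial.natDegree_sub_le _ _).trans ?_
    simp
  rw [Finset.sum_eq_zero (s := range _) fun k hk => by
    rw [h k (by rw [Finset.mem_range] at hk; omega), mul_zero]] at key
  rw [Finset.sum_eq_single g] at key
  · simpa [zero_pow (show Fintype.card L - 1 ≠ 0 by omega), Algebra.smul_def] using key
  · intro b _ hb
    simp [FiniteField.pow_card_sub_one_eq_one (b - g) (sub_ne_zero.mpr hb)]
  · simp

end PowerSums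

/-! ### The code consists of the affine functions -/

section Affine

variable {K L : Type*} [Field K] [Field L] [Fintype L] [Algebra K L]

/-- The word `∑ (b + f g) X^g` of an affine function `g ↦ b + f g` on `L`, where `f` is
`K`-linear. -/
def affineWord (b : K) (f : L →ₗ[K] K) : Word K L :=
  AddMonoidAlgebra.ofCoeff (Finsupp.equivFunOnFinite.symm fun g => b + f g)

@[simp]
lemma affineWord_coeff (b : K) (f : L →ₗ[K] K) (g : L) : (affineWord b f).coeff g = b + f g := rfl

variable [Fintype K]

lemma exists_trace_eq (f : L →ₗ[K] K) : ∃ a : L, ∀ g, f g = Algebra.trace K L (a * g) := by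
  have hB := traceForm_nondegenerate K L
  exact ⟨(LinearMap.BilinForm.toDual _ hB).symm f, fun g =>
    (LinearMap.BilinForm.apply_toDual_symm_apply (hB := hB) f g).symm⟩

variable {q m : ℕ} (hK : Fintype.card K = q) (hL : Fintype.card L = q ^ m)
include hK hL

lemma finrank_eq : Module.finrank K L = m := by
  have h := Module.card_eq_pow_finrank (K := K) (V := L)
  rw [hL, hK] at h
  exact (Nat.pow_right_injective (hK ▸ Fintype.one_lt_card : 2 ≤ q) h).symm

lemma algebraMap_trace_eq (x : L) :
    algebraMap K L (Algebra.trace K L x) = ∑ k ∈ range m, x ^ q ^ k := by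
  rw [FiniteField.algebraMap_trace_eq_sum_pow, finrank_eq hK hL, Nat.card_eq_fintype_card, hK]

/-- A linear form is `g ↦ Tr(a g)`, a sum of Frobenius powers of `a g`, so the functionals `phi` of
an affine word are combinations of power sums. -/
lemma phi_affineWord (b : K) (f : L →ₗ[K] K) (a : L) (ha : ∀ g, f g = Algebra.trace K L (a * g))
    (i : ℕ) : phi i (affineWord b f) =
      algebraMap K L b * ∑ g : L, g ^ i +
        ∑ k ∈ range m, a ^ q ^ k * ∑ g : L, g ^ (q ^ k + i) := by
  simp_rw [phi_apply, affineWord_coeff, Algebra.smul_def, map_add, ha, algebraMap_trace_eq hK hL,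
    add_mul, Finset.sum_add_distrib, Finset.mul_sum, Finset.sum_mul]
  rw [Finset.sum_comm]
  simp_rw [mul_pow, pow_add, mul_assoc]

lemma affineWord_mem_grmCode (hm : 0 < m) (b : K) (f : L →ₗ[K] K) :
    affineWord b f ∈ grmCode K L q m 1 := by
  have hq : 1 < q := hK ▸ Fintype.one_lt_card
  simp only [grmCode, Submodule.mem_iInf, LinearMap.mem_ker]
  intro i hi
  have hin : i < q ^ m - 1 := hi.1
  rw [mem_grmDefiningSet_one_iff hq hm hin.le] at hi
  obtain ⟨a, ha⟩ := exists_trace_eq f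
  rw [phi_affineWord hK hL b f a ha, FiniteField.sum_pow_lt_card_sub_one _ _ (by rwa [hL]),
    mul_zero, zero_add]
  refine Finset.sum_eq_zero fun k hk => ?_
  rw [Finset.mem_range] at hk
  have hk1 : q ^ k < q ^ m := Nat.pow_lt_pow_right hq hk
  rw [sum_pow_eq_ite, if_neg, mul_zero]
  rintro ⟨h1, h2⟩
  rw [hL] at h2
  have h3 := Nat.eq_of_dvd_of_lt_two_mul h1.ne' h2 (by omega)
  exact hi.2 k hk (by omega)

lemma phi_affineWord_sub_pow {k : ℕ} (hk : k < m) (hk1 : q ^ k < q ^ m - 1)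
    (b : K) (f : L →ₗ[K] K) (a : L) (ha : ∀ g, f g = Algebra.trace K L (a * g)) :
    phi (q ^ m - 1 - q ^ k) (affineWord b f) = -a ^ q ^ k := by
  have hq : 1 < q := hK ▸ Fintype.one_lt_card
  have hk0 : 0 < q ^ k := by positivity
  rw [phi_affineWord hK hL b f a ha, FiniteField.sum_pow_lt_card_sub_one _ _ (by rw [hL]; omega),
    mul_zero, zero_add, Finset.sum_eq_single k]
  · rw [sum_pow_eq_ite, if_pos, mul_neg_one]
    rw [hL]
    exact ⟨by omega, ⟨1, by omega⟩⟩
  · intro j hj hjk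
    rw [Finset.mem_range] at hj
    have hj1 : q ^ j < q ^ m := Nat.pow_lt_pow_right hq hj
    have hj0 : 0 < q ^ j := by positivity
    rw [sum_pow_eq_ite, if_neg, mul_zero]
    rintro ⟨h1, h2⟩
    rw [hL] at h2
    have h3 := Nat.eq_of_dvd_of_lt_two_mul h1.ne' h2 (by omega)
    exact hjk (Nat.pow_right_injective hq (show q ^ j = q ^ k by omega))
  · simp [hk]

/-- The functionals `phi` at the exponents outside the defining set are Frobenius conjugates. -/
lemma phi_sub_pow_eq {k : ℕ} (hk1 : q ^ k < q ^ m - 1) (x : Word K L) :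
    phi (q ^ m - 1 - q ^ k) x = phi (q ^ m - 1 - 1) x ^ q ^ k := by
  have hfrob : ∀ y : L, (FiniteField.frobeniusAlgHom K L ^ k) y = y ^ q ^ k := fun y => by
    rw [AlgHom.coe_pow, FiniteField.coe_frobeniusAlgHom, pow_iterate, hK]
  have hk0 : 0 < q ^ k := by
    have : 1 < q := hK ▸ Fintype.one_lt_card
    positivity
  rw [← hfrob, phi_apply, phi_apply, map_sum]
  refine Finset.sum_congr rfl fun g _ => ?_
  rw [map_smul, hfrob]
  congr 1
  rcases eq_or_ne g 0 with rfl | hg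
  · rw [zero_pow (by omega), zero_pow (by omega), zero_pow (by omega)]
  · have h1 : g ^ (q ^ m - 1) = 1 := by
      rw [← hL]; exact FiniteField.pow_card_sub_one_eq_one g hg
    refine mul_right_cancel₀ (pow_ne_zero (q ^ k) hg) ?_
    rw [← pow_add, ← mul_pow, ← pow_succ, Nat.sub_add_cancel (by omega),
      Nat.sub_add_cancel (by omega), h1, one_pow]

lemma phi_card_sub_one (hm : 0 < m) (x : Word K L) :
    phi (q ^ m - 1) x = phi 0 x - algebraMap K L (x.coeff 0) := by
  have hq : 1 < q := hK ▸ Fintype.one_lt_card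
  have hn : q ^ m - 1 ≠ 0 := by
    have := Nat.one_lt_pow hm.ne' hq
    omega
  rw [phi_apply, phi_apply, ← Finset.sum_erase_add _ _ (mem_univ (0 : L)),
    ← Finset.sum_erase_add univ (fun g => x.coeff g • g ^ 0) (mem_univ (0 : L)), zero_pow hn,
    smul_zero, add_zero, pow_zero, Algebra.smul_def, mul_one, add_sub_cancel_right]
  refine Finset.sum_congr rfl fun g hg => ?_
  rw [pow_zero, ← hL, FiniteField.pow_card_sub_one_eq_one g (by simpa using hg)]

/-- A word of the code is determined by its coefficient at `0` and one further functional: by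
Frobenius conjugacy the two make all functionals `phi i` with `i < q ^ m` vanish. -/
lemma eq_zero_of_mem_grmCode (h6 : 2 < q ^ m) {x : Word K L} (hx : x ∈ grmCode K L q m 1)
    (h0 : x.coeff 0 = 0) (h1 : phi (q ^ m - 1 - 1) x = 0) : x = 0 := by
  have hq : 1 < q := hK ▸ Fintype.one_lt_card
  have hm : 0 < m := Nat.pos_of_ne_zero (by rintro rfl; simp at h6)
  simp only [grmCode, Submodule.mem_iInf, LinearMap.mem_ker] at hx
  refine eq_zero_of_forall_phi_eq_zero x fun i hi => ?_
  rw [hL] at hi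
  by_cases hmem : i ∈ grmDefiningSet q m 1
  · exact hx i hmem
  rw [mem_grmDefiningSet_one_iff hq hm hi] at hmem
  push Not at hmem
  by_cases hin : i = q ^ m - 1
  · rw [hin, phi_card_sub_one hK hL hm, h0, hx 0 (zero_mem_grmDefiningSet hq h6)]
    simp
  · obtain ⟨k, hk, rfl⟩ := hmem hin
    rw [phi_sub_pow_eq hK hL (pow_lt_sub_one hq h6 hk), h1, zero_pow]
    positivity

/-- The first-order code consists of the words of the affine functions: subtracting a suitable
affine function kills the two remaining coordinates of a word. -/
theorem mem_grmCode_one_iff (h6 : 2 < q ^ m) {x : Word K L} :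
    x ∈ grmCode K L q m 1 ↔ ∃ (b : K) (f : L →ₗ[K] K), x = affineWord b f := by
  have hm : 0 < m := Nat.pos_of_ne_zero (by rintro rfl; simp at h6)
  have hq : 1 < q := hK ▸ Fintype.one_lt_card
  constructor
  · intro hx
    let a := -phi (q ^ m - 1 - 1) x
    let f : L →ₗ[K] K := Algebra.trace K L ∘ₗ LinearMap.mulLeft K a
    refine ⟨x.coeff 0, f, sub_eq_zero.mp <| eq_zero_of_mem_grmCode hK hL h6
      (Submodule.sub_mem _ hx (affineWord_mem_grmCode hK hL hm _ _)) (by simp) ?_⟩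
    have h := phi_affineWord_sub_pow hK hL hm (pow_lt_sub_one hq h6 hm) (x.coeff 0) f a
      fun g => rfl
    rw [pow_zero, pow_one] at h
    rw [map_sub, h]
    simp [a]
  · rintro ⟨b, f, rfl⟩
    exact affineWord_mem_grmCode hK hL hm b f

theorem definingSet_grmCode_one (h6 : 2 < q ^ m) :
    definingSet (grmCode K L q m 1) = grmDefiningSet q m 1 := by
  have hq : 1 < q := hK ▸ Fintype.one_lt_card
  have hm : 0 < m := Nat.pos_of_ne_zero (by rintro rfl; simp at h6)
  ext i
  constructor
  · rintro ⟨hi, h⟩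
    rw [hL] at hi
    rw [mem_grmDefiningSet_one_iff hq hm hi]
    refine ⟨?_, fun k hk => ?_⟩
    · rintro rfl
      have h1 := h _ (affineWord_mem_grmCode hK hL hm 1 0)
      rw [phi_card_sub_one hK hL hm, LinearMap.mem_ker.mp
        ((Submodule.mem_iInf _).mp ((Submodule.mem_iInf _).mp
          (affineWord_mem_grmCode hK hL hm 1 0) 0) (zero_mem_grmDefiningSet hq h6))] at h1
      simp at h1
    · rintro rfl
      have h1 := h _ (affineWord_mem_grmCode hK hL hm 0 (Algebra.trace K L))
      rw [phi_affineWord_sub_pow hK hL hk (pow_lt_sub_one hq h6 hk) _ _ 1 (by simp)] at h1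
      simp at h1
  · intro hi
    refine ⟨by rw [hL]; exact hi.1.le, fun x hx => ?_⟩
    simp only [grmCode, Submodule.mem_iInf, LinearMap.mem_ker] at hx
    exact hx i hi

end Affine

/-! ### Permutations acting on words -/

section Action

variable {K L : Type*} [Field K] [Field L] [Fintype L] [Algebra K L]

omit [Fintype L] [Algebra K L] in
@[simp]
lemma act_coeff (τ : Equiv.Perm L) (x : Word K L) (g : L) :
    (act τ x).coeff g = x.coeff (τ⁻¹ g) := by
  have h := Finsupp.mapDomain_apply τ.injective x.coeff (τ⁻¹ g)
  rw [← Equiv.Perm.mul_apply, mul_inv_cancel, Equiv.Perm.one_apply] at h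
  exact h

omit [Fintype L] [Algebra K L] in
lemma act_act (σ τ : Equiv.Perm L) (x : Word K L) : act σ (act τ x) = act (σ * τ) x := by
  ext g
  simp

omit [Fintype L] [Algebra K L] in
lemma act_one (x : Word K L) : act 1 x = x := by
  ext g
  simp

omit [Fintype L] [Algebra K L] in
lemma act_add (τ : Equiv.Perm L) (x y : Word K L) : act τ (x + y) = act τ x + act τ y := by
  ext g
  simp

omit [Fintype L] [Algebra K L] in
lemma mem_PAut_of_act_mem {C : Submodule K (Word K L)} {τ : Equiv.Perm L}
    (h : ∀ c ∈ C, act τ c ∈ C) (h' : ∀ c ∈ C, act τ⁻¹ c ∈ C) : τ ∈ PAut C := by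
  apply Set.Subset.antisymm
  · rintro _ ⟨c, hc, rfl⟩
    exact h c hc
  · intro c hc
    exact ⟨act τ⁻¹ c, h' c hc, by rw [act_act, mul_inv_cancel, act_one]⟩

omit [Algebra K L] in
lemma weight_act (τ : Equiv.Perm L) (x : Word K L) : weight (act τ x) = weight x := by
  unfold weight hammingNorm
  refine Finset.card_bij' (fun g _ => τ⁻¹ g) (fun g _ => τ g) ?_ ?_ ?_ ?_ <;> simp

omit [Fintype L] [Algebra K L] in
lemma single_mul_coeff (h : L) (a : K) (x : Word K L) (g : L) :
    (AddMonoidAlgebra.single h a * x).coeff g = a * x.coeff (g - h) := by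
  rw [AddMonoidAlgebra.coeff_single_mul_apply, neg_add_eq_sub]

omit [Algebra K L] in
/-- An automorphism of the punctured code extends to the code when all words have coefficient sum
zero, because the coefficient at `0` is then determined by the others. -/
lemma act_extend_mem {C : Submodule K (Word K L)} (hC : ∀ c ∈ C, ∑ g : L, c.coeff g = 0)
    {τ : Equiv.Perm (GStar L)} (hτ : τ ∈ PAutStar C) {c : Word K L} (hc : c ∈ C) :
    act (extend τ) c ∈ C := by
  have h : (puncture c : GStar L → K) ∘ τ.symm ∈ (punctured C : Set (GStar L → K)) := by
    rw [← show _ = _ from hτ]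
    exact ⟨_, ⟨c, hc, rfl⟩, rfl⟩
  obtain ⟨c', hc', h'⟩ := h
  have hne : ∀ g : L, g ≠ 0 → c'.coeff g = (act (extend τ) c).coeff g := fun g hg => by
    have h1 := congrFun h' ⟨g, hg⟩
    have h2 : (extend τ)⁻¹ g = τ.symm ⟨g, hg⟩ := by
      rw [extend, ← map_inv, Equiv.Perm.ofSubtype_apply_of_mem (p := fun g : L => g ≠ 0) _ hg]
      rfl
    rw [act_coeff, h2]
    exact h1
  have hsum : ∑ g : L, (act (extend τ) c).coeff g = 0 := by
    simp_rw [act_coeff]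
    rw [Equiv.sum_comp (extend τ)⁻¹ (fun g => c.coeff g)]
    exact hC c hc
  have h0 : c'.coeff 0 = (act (extend τ) c).coeff 0 := by
    have h1 := hC c' hc'
    rw [← Finset.add_sum_erase _ _ (mem_univ (0 : L))] at h1 hsum
    rw [Finset.sum_congr rfl fun g hg => hne g (by simpa using hg)] at h1
    exact add_right_cancel (h1.trans hsum.symm)
  have : c' = act (extend τ) c := by
    ext g
    by_cases hg : g = 0
    · rw [hg, h0]
    · exact hne g hg
  rwa [← this]

/-- Multiplication by the units of `L`, as permutations of `G^*`. -/
def scaling : Lˣ →* Equiv.Perm (GStar L) where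
  toFun := T
  map_one' := by ext g; simp [T]
  map_mul' a b := by ext g; simp [T, mul_assoc]

omit [Fintype L] in
lemma T_zpow (α : Lˣ) (k : ℤ) : T α ^ k = T (α ^ k) := (map_zpow (scaling (L := L)) α k).symm

omit [Fintype L] [Algebra K L] in
lemma mem_PAutStar_T {C : Submodule K (Word K L)}
    (h : ∀ a : Lˣ, ∀ c ∈ C, act (affinePerm a 0) c ∈ C)
    (a : Lˣ) : T a ∈ PAutStar C := by
  have key : ∀ (a : Lˣ) (c : Word K L), (puncture c : GStar L → K) ∘ (T a).symm =
      puncture (act (affinePerm a 0) c) := by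
    intro a c
    ext g
    have : (affinePerm a 0)⁻¹ g.1 = ↑a⁻¹ * g.1 := by
      rw [Equiv.Perm.inv_eq_iff_eq]
      simp [affinePerm]
    simp [puncture, T, this]
  have hsub : ∀ (a : Lˣ) (v : GStar L → K), v ∈ punctured C → v ∘ (T a).symm ∈ punctured C := by
    rintro a _ ⟨c, hc, rfl⟩
    rw [key]
    exact ⟨_, h a c hc, rfl⟩
  apply Set.Subset.antisymm
  · rintro _ ⟨v, hv, rfl⟩
    exact hsub a v hv
  · intro v hv
    refine ⟨v ∘ (T a⁻¹).symm, hsub a⁻¹ v hv, ?_⟩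
    ext g
    simp [T]

end Action

/-! ### Affine invariance -/

section AffineInvariance

variable {K L : Type*} [Field K] [Field L] [Fintype L] [Algebra K L]

omit [Fintype L] in
lemma affinePerm_apply (a : Lˣ) (b g : L) : affinePerm a b g = a * g + b := rfl

omit [Fintype L] in
lemma affinePerm_inv (a : Lˣ) (b : L) : (affinePerm a b)⁻¹ = affinePerm a⁻¹ (-(↑a⁻¹ * b)) := by
  rw [inv_eq_iff_mul_eq_one]
  ext g
  simp [affinePerm_apply, mul_add]

lemma act_affinePerm_affineWord (a : Lˣ) (b : L) (b' : K) (f : L →ₗ[K] K) :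
    act (affinePerm a b) (affineWord b' f) =
      affineWord (b' - f (↑a⁻¹ * b)) (f ∘ₗ LinearMap.mulLeft K (↑a⁻¹ : L)) := by
  ext g
  rw [act_coeff, affinePerm_inv, affineWord_coeff, affineWord_coeff, affinePerm_apply, map_add,
    map_neg]
  simp
  ring

variable [Fintype K] {q m : ℕ} (hK : Fintype.card K = q) (hL : Fintype.card L = q ^ m)
include hK hL

lemma act_affinePerm_mem (h6 : 2 < q ^ m) (a : Lˣ) (b : L) {c : Word K L}
    (hc : c ∈ grmCode K L q m 1) : act (affinePerm a b) c ∈ grmCode K L q m 1 := by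
  rw [mem_grmCode_one_iff hK hL h6] at hc ⊢
  obtain ⟨b', f, rfl⟩ := hc
  exact ⟨_, _, act_affinePerm_affineWord a b b' f⟩

omit hL in
lemma sum_coeff_eq_zero (h6 : 2 < q ^ m) {c : Word K L} (hc : c ∈ grmCode K L q m 1) :
    ∑ g : L, c.coeff g = 0 := by
  have hq : 1 < q := hK ▸ Fintype.one_lt_card
  have h := LinearMap.mem_ker.mp ((Submodule.mem_iInf _).mp ((Submodule.mem_iInf _).mp hc 0)
    (zero_mem_grmDefiningSet hq h6))
  apply (algebraMap K L).injective
  simpa [phi_apply, Algebra.smul_def] using h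

theorem isAffineInvariant_grmCode (h6 : 2 < q ^ m) (α : Lˣ) :
    IsAffineInvariant α (grmCode K L q m 1) where
  extendedCyclic :=
    { ideal := by
        intro x c hc
        induction x using AddMonoidAlgebra.induction_linear with
        | zero => simp
        | add x y hx hy => rw [add_mul]; exact Submodule.add_mem _ hx hy
        | single h a =>
          have : AddMonoidAlgebra.single h a * c = a • act (affinePerm 1 h) c := by
            ext g
            rw [single_mul_coeff, AddMonoidAlgebra.coeff_smul_apply, act_coeff, affinePerm_inv,
              affinePerm_apply]
            simp [sub_eq_add_neg]
          rw [this]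
          exact Submodule.smul_mem _ _ (act_affinePerm_mem hK hL h6 1 h hc)
      shift := fun c hc => act_affinePerm_mem hK hL h6 α 0 hc
      sum_eq_zero := fun c hc => sum_coeff_eq_zero hK h6 hc }
  affine a b := mem_PAut_of_act_mem (fun c hc => act_affinePerm_mem hK hL h6 a b hc)
    fun c hc => by rw [affinePerm_inv]; exact act_affinePerm_mem hK hL h6 _ _ hc

end AffineInvariance

/-! ### Multiplicative orders -/

/-- If `r₁ r₂ = q ^ m - 1` and both orders of `q` were proper divisors `a`, `b` of `m`, then
`q ^ m - 1` would be at most `(q ^ a - 1) (q ^ b - 1) < q ^ m - 1`. -/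
lemma orderOf_eq_or_orderOf_eq {q m r₁ r₂ : ℕ} (hq : 1 < q) (hm : 0 < m)
    (h : q ^ m - 1 = r₁ * r₂) :
    orderOf (q : ZMod r₁) = m ∨ orderOf (q : ZMod r₂) = m := by
  have hpos : ∀ k, 0 < q ^ k := fun k => by positivity
  have hmod : ∀ r k : ℕ, (q : ZMod r) ^ k = 1 ↔ r ∣ q ^ k - 1 := fun r k => by
    rw [← Nat.modEq_iff_dvd' (hpos k), ← ZMod.natCast_eq_natCast_iff]
    push_cast
    exact eq_comm
  have h1 : orderOf (q : ZMod r₁) ∣ m :=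
    orderOf_dvd_of_pow_eq_one ((hmod _ _).mpr (h ▸ dvd_mul_right _ _))
  have h2 : orderOf (q : ZMod r₂) ∣ m :=
    orderOf_dvd_of_pow_eq_one ((hmod _ _).mpr (h ▸ dvd_mul_left _ _))
  have d1 := (hmod _ _).mp (pow_orderOf_eq_one (q : ZMod r₁))
  have d2 := (hmod _ _).mp (pow_orderOf_eq_one (q : ZMod r₂))
  generalize orderOf (q : ZMod r₁) = a at *
  generalize orderOf (q : ZMod r₂) = b at *
  by_contra! hne
  have half : ∀ c, c ∣ m → c ≠ m → 0 < c ∧ 2 * c ≤ m := by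
    rintro c ⟨k, rfl⟩ hc
    have hc0 : 0 < c := Nat.pos_of_mul_pos_right hm
    have hk0 : 0 < k := Nat.pos_of_mul_pos_left hm
    have : k ≠ 1 := by rintro rfl; simp at hc
    exact ⟨hc0, by rw [mul_comm]; exact Nat.mul_le_mul_left c (by omega)⟩
  obtain ⟨a0, ha⟩ := half a h1 hne.1
  obtain ⟨b0, hb⟩ := half b h2 hne.2
  have ha1 := Nat.one_lt_pow a0.ne' hq
  have hb1 := Nat.one_lt_pow b0.ne' hq
  have e1 := Nat.le_of_dvd (by omega) d1
  have e2 := Nat.le_of_dvd (by omega) d2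
  have e3 := Nat.mul_le_mul e1 e2
  -- expanding `(q ^ a - 1) (q ^ b - 1)` with `q ^ a = u + 2` and `q ^ b = v + 2`
  have e4 : q ^ a * q ^ b ≤ q ^ m := by
    rw [← pow_add]
    exact Nat.pow_le_pow_right (by omega) (by omega)
  obtain ⟨u, hu⟩ := Nat.exists_eq_add_of_lt ha1
  obtain ⟨v, hv⟩ := Nat.exists_eq_add_of_lt hb1
  rw [← h, hu, hv, show 1 + u + 1 - 1 = u + 1 by omega, show 1 + v + 1 - 1 = v + 1 by omega] at e3
  rw [hu, hv] at e4
  ring_nf at e3 e4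
  omega

/-! ### Information sets and standard parity check matrices -/

section Systematic

variable {K L : Type*} [Field K] [Field L] [Fintype L]

/-- If restriction to `I` is a bijection from `C` to `K^I`, then `I` is an information set; the
dimension of `C` need not be known beforehand. -/
lemma isInformationSet_of_bijective {C : Submodule K (Word K L)} {I : Set L}
    (hsurj : ∀ y : I → K, ∃ c ∈ C, ∀ i : I, c.coeff i.1 = y i)
    (hinj : ∀ c ∈ C, (∀ i ∈ I, c.coeff i = 0) → c = 0) : IsInformationSet C I := by
  refine ⟨?_, hsurj⟩
  let f : C →ₗ[K] (I → K) :=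
    { toFun := fun c i => c.1.coeff i.1
      map_add' := fun x y => by ext; simp
      map_smul' := fun a x => by ext; simp }
  have hf : Function.Bijective f := by
    constructor
    · rw [injective_iff_map_eq_zero]
      intro c hc
      exact Subtype.ext (hinj c.1 c.2 fun i hi => congrFun hc ⟨i, hi⟩)
    · intro y
      obtain ⟨c, hc, h⟩ := hsurj y
      exact ⟨⟨c, hc⟩, funext h⟩
  rw [(LinearEquiv.ofBijective f hf).finrank_eq, Module.finrank_fintype_fun_eq_card,
    Set.ncard_eq_toFinset_card', Set.toFinset_card]

/-- The check columns outside `I` are fixed to be the identity; the columns in `I` are the negatives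
of the codewords that restrict to the standard basis of `K^I`. -/
lemma exists_isStandardParityCheck {C : Submodule K (Word K L)} {I : Set L}
    (hsurj : ∀ y : I → K, ∃ c ∈ C, ∀ i : I, c.coeff i.1 = y i)
    (hinj : ∀ c ∈ C, (∀ i ∈ I, c.coeff i = 0) → c = 0) : ∃ H, IsStandardParityCheck C I H := by
  choose b hb hbi using fun i : I => hsurj (Pi.single i 1)
  let H : Matrix {g : L // g ∉ I} L K := fun g h =>
    if hh : h ∈ I then -(b ⟨h, hh⟩).coeff g.1 else if g.1 = h then 1 else 0
  have hH : ∀ (x : Word K L) (g : {g : L // g ∉ I}),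
      syndrome H x g = x.coeff g.1 - ∑ i : I, x.coeff i.1 * (b i).coeff g.1 := by
    intro x g
    have h1 : ∀ h : L, H g h * x.coeff h =
        (if hh : h ∈ I then -(b ⟨h, hh⟩).coeff g.1 * x.coeff h else 0) +
          if h = g.1 then x.coeff g.1 else 0 := by
      intro h
      by_cases hh : h ∈ I
      · have : h ≠ g.1 := fun e => g.2 (e ▸ hh)
        simp [H, hh, this]
      · by_cases e : h = g.1
        · subst e
          simp [H, hh]
        · simp [H, hh, e, Ne.symm e]
    have h2 : syndrome H x g = ∑ h : L, H g h * x.coeff h := rfl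
    rw [h2, Finset.sum_congr rfl fun h _ => h1 h, Finset.sum_add_distrib, Finset.sum_ite_eq' univ,
      if_pos (mem_univ _), add_comm, sub_eq_add_neg, ← Finset.sum_neg_distrib]
    congr 1
    rw [← Finset.sum_subset (subset_univ I.toFinset) fun h _ hh => dif_neg (by simpa using hh),
      ← Finset.sum_coe_sort]
    refine Finset.sum_bij' (fun i _ => ⟨i.1, Set.mem_toFinset.mp i.2⟩)
      (fun i _ => ⟨i.1, by simp⟩) ?_ ?_ ?_ ?_ ?_
    · simp
    · simp
    · simp
    · simp
    · rintro ⟨i, hi⟩ _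
      have hi' : i ∈ I := by simpa using hi
      simp [hi', mul_comm]
  refine ⟨H, fun x => ?_, fun i j => ?_⟩
  · let y : Word K L := ∑ i : I, x.coeff i.1 • b i
    have hy : y ∈ C := Submodule.sum_mem _ fun i _ => Submodule.smul_mem _ _ (hb i)
    have hyg : ∀ g, y.coeff g = ∑ i : I, x.coeff i.1 * (b i).coeff g := fun g => by
      simp [y, AddMonoidAlgebra.coeff_sum, Finsupp.finsetSum_apply]
    have hyI : ∀ i ∈ I, y.coeff i = x.coeff i := fun i hi => by
      rw [hyg, Finset.sum_eq_single ⟨i, hi⟩]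
      · rw [hbi _ ⟨i, hi⟩]; simp
      · intro j _ hj
        rw [hbi j ⟨i, hi⟩]; simp [hj.symm]
      · simp
    constructor
    · intro hx
      have : x - y = 0 := hinj _ (Submodule.sub_mem _ hx hy) fun i hi => by
        simp [hyI i hi]
      rw [sub_eq_zero] at this
      ext g
      rw [hH, ← hyg, ← this]
      simp
    · intro hx
      have : x = y := by
        ext g
        by_cases hg : g ∈ I
        · exact (hyI g hg).symm
        · have := congrFun hx ⟨g, hg⟩
          rw [hH, ← hyg] at this
          exact sub_eq_zero.mp this
      rw [this]
      exact hy
  · by_cases e : i = j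
    · simp [H, e, j.2]
    · have : ¬ i.1 = j.1 := fun h => e (Subtype.ext h)
      simp [H, e, this, j.2]

lemma syndrome_sub {I : Set L} (H : Matrix {g : L // g ∉ I} L K) (x y : Word K L) :
    syndrome H (x - y) = syndrome H x - syndrome H y := by
  have : (fun g : L => (x - y).coeff g) = (fun g => x.coeff g) - fun g => y.coeff g := by
    ext g; simp
  rw [syndrome, this, Matrix.mulVec_sub]
  rfl

lemma syndrome_apply {C : Submodule K (Word K L)} {I : Set L} {H : Matrix {g : L // g ∉ I} L K}
    (hH : IsStandardParityCheck C I H) (x : Word K L) (g : {g : L // g ∉ I}) :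
    syndrome H x g = ∑ i : I, H g i.1 * x.coeff i.1 + x.coeff g.1 := by
  have h : syndrome H x g = ∑ h : L, H g h * x.coeff h := rfl
  rw [h, ← Finset.sum_filter_add_sum_filter_not univ (· ∈ I)]
  congr 1
  · refine (Finset.sum_subtype _ (fun x => ?_) _)
    simp
  · rw [Finset.sum_eq_single g.1]
    · rw [hH.2 g g, if_pos rfl, one_mul]
    · intro b hb hbg
      rw [hH.2 g ⟨b, (Finset.mem_filter.mp hb).2⟩, if_neg, zero_mul]
      exact fun e => hbg (congrArg Subtype.val e).symm
    · intro h
      exact (h (by simpa using g.2)).elim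

/-- If a word vanishes on the information set, its syndrome is the rest of the word. -/
lemma hammingNorm_syndrome {C : Submodule K (Word K L)} {I : Set L}
    {H : Matrix {g : L // g ∉ I} L K} (hH : IsStandardParityCheck C I H) {x : Word K L}
    (hx : ∀ i ∈ I, x.coeff i = 0) : hammingNorm (syndrome H x) = weight x := by
  have h : ∀ g : {g : L // g ∉ I}, syndrome H x g = x.coeff g.1 := fun g => by
    rw [syndrome_apply hH, Finset.sum_eq_zero fun i _ => by rw [hx i.1 i.2, mul_zero], zero_add]
  unfold weight hammingNorm
  refine Finset.card_bij (fun g _ => g.1) ?_ (fun _ _ _ _ => Subtype.ext) ?_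
  · intro g hg
    simpa [h] using hg
  · intro g hg
    have hgI : g ∉ I := fun e => by simp [hx g e] at hg
    exact ⟨⟨g, hgI⟩, by simpa [h] using hg, rfl⟩

lemma reencode_coeff_of_mem {I : Set L} (H : Matrix {g : L // g ∉ I} L K) (v : Word K L)
    {g : L} (hg : g ∈ I) : (reencode H v).coeff g = v.coeff g :=
  dif_neg (not_not.mpr hg)

lemma reencode_mem {C : Submodule K (Word K L)} {I : Set L} {H : Matrix {g : L // g ∉ I} L K}
    (hH : IsStandardParityCheck C I H) (v : Word K L) : reencode H v ∈ C := by
  rw [hH.1]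
  ext g
  have h : (reencode H v).coeff g.1 = -∑ i : I, H g i.1 * v.coeff i.1 := dif_pos g.2
  rw [syndrome_apply hH, h,
    Finset.sum_congr rfl fun i _ => by rw [reencode_coeff_of_mem H v i.2], add_neg_cancel]
  rfl

/-- A syndrome of small weight certifies that the received word is close to the codeword with the
same information symbols. -/
lemma weight_sub_reencode {C : Submodule K (Word K L)} {I : Set L}
    {H : Matrix {g : L // g ∉ I} L K} (hH : IsStandardParityCheck C I H) (v : Word K L) :
    weight (v - reencode H v) = hammingNorm (syndrome H v) := by
  rw [← hammingNorm_syndrome hH fun i hi => by simp [reencode_coeff_of_mem H v hi], syndrome_sub,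
    (hH.1 _).mp (reencode_mem hH v), sub_zero]

lemma weight_sub (x y : Word K L) :
    weight (x - y) = hammingDist (fun g => x.coeff g) fun g => y.coeff g := by
  simp [weight, hammingNorm, hammingDist, sub_eq_zero]

/-- Two codewords at distance at most twice the error correction capability coincide. -/
lemma eq_of_weight_sub_le {C : Submodule K (Word K L)} {x y : Word K L} (hx : x ∈ C) (hy : y ∈ C)
    (h : weight (x - y) ≤ 2 * capability C) : x = y := by
  by_contra hne
  have hmem : weight (x - y) ∈ {d | ∃ x ∈ C, ∃ y ∈ C, x ≠ y ∧
      d = hammingDist (fun g : L => x.coeff g) fun g => y.coeff g} :=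
    ⟨x, hx, y, hy, hne, weight_sub x y⟩
  have h1 : minDist C ≤ weight (x - y) := Nat.sInf_le hmem
  obtain ⟨x', _, y', _, hne', hd⟩ := Nat.sInf_mem ⟨_, hmem⟩
  have h2 : 0 < minDist C := by
    unfold minDist
    rw [hd, hammingDist_pos]
    intro e
    exact hne' (by ext g; exact congrFun e g)
  unfold capability at h
  omega

end Systematic

/-! ### The decoding algorithm -/

section Decoding

variable {K L : Type*} [Field K] [Field L] [Fintype L]

/-- Every pair at which the algorithm can stop yields the transmitted codeword. -/
lemma act_inv_reencode_eq {C : Submodule K (Word K L)} {I : Set L}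
    {H : Matrix {g : L // g ∉ I} L K} (hH : IsStandardParityCheck C I H) {ρ : Equiv.Perm L}
    (hρ : ∀ c ∈ C, act ρ c ∈ C) {c e : Word K L} (hc : c ∈ C) (he : weight e ≤ capability C)
    (hs : hammingNorm (syndrome H (act ρ (c + e))) ≤ capability C) :
    act ρ⁻¹ (reencode H (act ρ (c + e))) = c := by
  have h1 := weight_sub_reencode hH (act ρ (c + e))
  have h2 : reencode H (act ρ (c + e)) = act ρ c := by
    refine (eq_of_weight_sub_le (hρ c hc) (reencode_mem hH _) ?_).symm
    have h3 : weight (act ρ c - act ρ (c + e)) = weight e := by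
      rw [← weight_act ρ e, act_add]
      unfold weight hammingNorm
      simp
    have h4 := hammingDist_triangle (fun g => (act ρ c).coeff g)
      (fun g => (act ρ (c + e)).coeff g) fun g => (reencode H (act ρ (c + e))).coeff g
    rw [← weight_sub, ← weight_sub, ← weight_sub] at h4
    omega
  rw [h2, act_act, inv_mul_cancel, act_one]

/-- A permutation that moves the errors out of the information set turns the syndrome into one of
the weight of the error, so that the algorithm stops. -/
lemma hammingNorm_syndrome_act {C : Submodule K (Word K L)} {I : Set L}
    {H : Matrix {g : L // g ∉ I} L K} (hH : IsStandardParityCheck C I H) {ρ : Equiv.Perm L}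
    (hρ : ∀ c ∈ C, act ρ c ∈ C) {c e : Word K L} (hc : c ∈ C)
    (hI : ∀ g, e.coeff g ≠ 0 → ρ g ∉ I) :
    hammingNorm (syndrome H (act ρ (c + e))) = weight e := by
  have h1 : syndrome H (act ρ (c + e)) = syndrome H (act ρ e) := by
    have := syndrome_sub H (act ρ (c + e)) (act ρ c)
    rw [(hH.1 _).mp (hρ c hc), sub_zero] at this
    rw [← this, act_add, add_sub_cancel_left]
  rw [h1, hammingNorm_syndrome hH, weight_act]
  intro i hi
  by_contra h
  rw [act_coeff] at h
  exact hI _ h (by simpa using hi)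

/-- Some translation in the list carries an error-free position to `0`, which clears the position
`0` that no element of the PD-like set can move. -/
lemma exists_translation {α : Lˣ} (hα : ∀ x : Lˣ, x ∈ Subgroup.zpowers α) {n : ℕ}
    (hn : n = Fintype.card L - 1) {e : Word K L} (he : weight e < Fintype.card L) :
    ∃ σ ∈ translations n α, σ⁻¹ 0 ∉ {g | e.coeff g ≠ 0} := by
  by_cases h0 : e.coeff 0 = 0
  · exact ⟨1, by simp [translations], by simpa using h0⟩
  · obtain ⟨g, hg⟩ : ∃ g, e.coeff g = 0 := by
      by_contra! h
      have : weight e = Fintype.card L := by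
        unfold weight hammingNorm
        rw [Finset.filter_true_of_mem fun g _ => h g, Finset.card_univ]
      omega
    have hg0 : -g ≠ 0 := by
      rw [neg_ne_zero]
      rintro rfl
      exact h0 hg
    obtain ⟨k, hk, hk'⟩ : ∃ k < n, α ^ k = Units.mk0 (-g) hg0 := by
      have hfin : IsOfFinOrder α := isOfFinOrder_of_finite α
      obtain ⟨k, hk⟩ := (hfin.mem_zpowers_iff_mem_range_orderOf).mp (hα (Units.mk0 (-g) hg0)) |>
        Finset.mem_image.mp
      refine ⟨k, ?_, hk.2⟩
      have h1 := orderOf_le_card_univ (x := α)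
      rw [Fintype.card_units, ← hn] at h1
      have := Finset.mem_range.mp hk.1
      omega
    refine ⟨Equiv.addRight ((α : L) ^ k), ?_, ?_⟩
    · simp only [translations, List.mem_cons, List.mem_map, List.mem_range]
      exact Or.inr ⟨k, hk, rfl⟩
    · have h1 : (α : L) ^ k = -g := by
        rw [← Units.val_pow_eq_pow_val, hk']
        rfl
      have h2 : (Equiv.addRight ((α : L) ^ k))⁻¹ 0 = g := by
        rw [Equiv.Perm.inv_eq_iff_eq]
        simp [h1]
      rw [h2]
      simpa using hg

lemma capability_lt_card (C : Submodule K (Word K L)) : capability C < Fintype.card L := by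
  have h : minDist C ≤ Fintype.card L := by
    unfold minDist
    rcases Set.eq_empty_or_nonempty {d | ∃ x ∈ C, ∃ y ∈ C, x ≠ y ∧
      d = hammingDist (fun g : L => x.coeff g) fun g => y.coeff g} with h | h
    · rw [h]; simp
    · obtain ⟨x, _, y, _, _, hd⟩ := Nat.sInf_mem h
      rw [hd]
      exact hammingDist_le_card_fintype
  have : 0 < Fintype.card L := Fintype.card_pos
  unfold capability
  omega

/-- The algorithm corrects up to `s` errors for every code that is invariant under the translations
and whose words have coefficient sum zero. -/
theorem correctsUpTo_algorithmI {C : Submodule K (Word K L)}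
    (hsum : ∀ c ∈ C, ∑ g : L, c.coeff g = 0)
    (htrans : ∀ b : L, ∀ c ∈ C, act (Equiv.addRight b) c ∈ C)
    {α : Lˣ} (hα : ∀ x : Lˣ, x ∈ Subgroup.zpowers α) {n : ℕ} (hn : n = Fintype.card L - 1)
    {I : Set L} {H : Matrix {g : L // g ∉ I} L K} (hH : IsStandardParityCheck C I H)
    {s : ℕ} (hs : s ≤ capability C) {P : List (Equiv.Perm (GStar L))}
    (hP : IsPDLikeSet C (prime I) s {τ | τ ∈ P}) :
    CorrectsUpTo C s (algorithmI n α H P (capability C)) := by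
  intro c hc e he
  have hσ : ∀ σ ∈ translations n α, ∀ c ∈ C, act σ c ∈ C := by
    intro σ h c hc
    simp only [translations, List.mem_cons, List.mem_map] at h
    rcases h with rfl | ⟨k, -, rfl⟩
    · rwa [act_one]
    · exact htrans _ c hc
  have hρ : ∀ σ ∈ translations n α, ∀ τ ∈ P, ∀ c ∈ C, act (extend τ * σ) c ∈ C := by
    intro σ h τ hτ c hc
    rw [← act_act]
    exact act_extend_mem hsum (hP.1 hτ) (hσ σ h c hc)
  obtain ⟨y, hy⟩ : ∃ y, algorithmI n α H P (capability C) (c + e) = some y := by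
    obtain ⟨σ, hσ', h0⟩ := exists_translation hα hn
      ((he.trans hs).trans_lt (capability_lt_card C))
    -- the error positions of the translated word all lie in `G^*`; they are padded to exactly `s`
    -- positions, which is what the PD-like property requires
    have hcard : (univ.filter fun g : GStar L => e.coeff (σ⁻¹ g.1) ≠ 0).card ≤ s := by
      refine le_trans ?_ he
      refine Finset.card_le_card_of_injOn (fun g => σ⁻¹ g.1) ?_ ?_
      · intro g hg
        simpa using hg
      · intro g _ h _ hgh
        exact Subtype.ext (σ⁻¹.injective hgh)
    obtain ⟨B, hB, hBs⟩ := Finset.exists_superset_card_eq hcard (by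
      have := capability_lt_card C
      rw [Fintype.card_subtype_compl, Fintype.card_subtype_eq]
      omega)
    obtain ⟨τ, hτ, hτB⟩ := hP.2 B hBs
    have hle : hammingNorm (syndrome H (act (extend τ) (act σ (c + e)))) ≤ capability C := by
      rw [act_act, hammingNorm_syndrome_act hH (hρ σ hσ' τ hτ) hc]
      · exact he.trans hs
      · intro g hg
        have hg0 : σ g ≠ 0 := by
          intro h
          apply h0
          rw [← h, ← Equiv.Perm.mul_apply, inv_mul_cancel]
          exact hg
        have h1 : (extend τ * σ) g = (τ ⟨σ g, hg0⟩ : L) := by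
          rw [Equiv.Perm.mul_apply, extend,
            Equiv.Perm.ofSubtype_apply_of_mem (p := fun g : L => g ≠ 0) _ hg0]
        rw [h1]
        refine hτB _ (hB ?_)
        rw [Finset.mem_filter, ← Equiv.Perm.mul_apply, inv_mul_cancel]
        exact ⟨mem_univ _, hg⟩
    rw [← Option.isSome_iff_exists, algorithmI, List.findSome?_isSome_iff]
    refine ⟨σ, hσ', ?_⟩
    rw [Option.isSome_map, List.find?_isSome]
    exact ⟨τ, hτ, decide_eq_true hle⟩
  rw [hy]
  obtain ⟨σ, hσ', h1⟩ := List.exists_of_findSome?_eq_some hy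
  obtain ⟨τ, h2, rfl⟩ := Option.map_eq_some_iff.mp h1
  have h3 := List.find?_some h2
  simp only [decide_eq_true_eq] at h3
  rw [act_act] at h3 ⊢
  rw [act_inv_reencode_eq hH (hρ σ hσ' τ (List.mem_of_find?_eq_some h2)) hc (he.trans hs) h3]

end Decoding

/-! ### The information set `Γ` -/

/-- The element `α ^ i` with `φ i = (1, 0)`. For a generator `α` it has order `r₁`. -/
def rowGenerator {L : Type*} [Field L] {n r₁ r₂ : ℕ} (α : Lˣ)
    (φ : ZMod n ≃+ ZMod r₁ × ZMod r₂) : Lˣ :=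
  α ^ (φ.symm (1, 0)).val

section Exponents

variable {L : Type*} [Field L] [Fintype L] {α : Lˣ} (hα : ∀ x : Lˣ, x ∈ Subgroup.zpowers α)
  {n : ℕ} (hn : n = Fintype.card L - 1)
include hα hn

lemma orderOf_generator : orderOf α = n := by
  rw [orderOf_eq_card_of_forall_mem_zpowers hα, Nat.card_eq_fintype_card, Fintype.card_units, hn]

lemma pow_val_natCast (k : ℕ) : α ^ (k : ZMod n).val = α ^ k := by
  rw [ZMod.val_natCast, ← orderOf_generator hα hn, pow_mod_orderOf]

lemma pow_val_add [NeZero n] (i j : ZMod n) : α ^ (i + j).val = α ^ i.val * α ^ j.val := by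
  rw [← pow_add, ← pow_val_natCast hα hn (i.val + j.val)]
  simp

lemma pow_val_injective [NeZero n] : Function.Injective fun i : ZMod n => α ^ i.val := by
  intro i j h
  refine ZMod.val_injective n (pow_injOn_Iio_orderOf ?_ ?_ h) <;>
  · rw [Set.mem_Iio, orderOf_generator hα hn]
    exact ZMod.val_lt _

lemma exists_pow_val_eq [NeZero n] (x : Lˣ) : ∃ i : ZMod n, α ^ i.val = x := by
  have h : Function.Bijective fun i : ZMod n => α ^ i.val :=
    (Fintype.bijective_iff_injective_and_card _).mpr ⟨pow_val_injective hα hn, by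
      rw [ZMod.card, Fintype.card_units, hn]⟩
  exact h.2 x

lemma pow_val_nsmul [NeZero n] (j : ℕ) (i : ZMod n) : α ^ (j • i).val = (α ^ i.val) ^ j := by
  rw [← pow_mul, ← pow_val_natCast hα hn (i.val * j)]
  simp [mul_comm]

variable {r₁ r₂ : ℕ} (φ : ZMod n ≃+ ZMod r₁ × ZMod r₂)

lemma dvd_of_rowGenerator_pow_eq_one [NeZero n] {j : ℕ} (h : rowGenerator α φ ^ j = 1) :
    r₁ ∣ j := by
  rw [rowGenerator, ← pow_val_nsmul hα hn] at h
  have h0 : j • φ.symm (1, 0) = 0 := pow_val_injective hα hn (by simpa using h)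
  rw [← map_nsmul, EmbeddingLike.map_eq_zero_iff] at h0
  have := congrArg Prod.fst h0
  rw [← ZMod.natCast_eq_zero_iff]
  simpa using this

lemma mem_infoSet_iff [NeZero n] [NeZero r₁] [NeZero r₂] {m : ℕ} (hm : m ≤ r₁) {x : L} :
    x ∈ infoSet m α φ ↔ x = 0 ∨ ∃ j < m, x = (rowGenerator α φ : L) ^ j := by
  have key : ∀ j : ℕ, (α : L) ^ (j • φ.symm (1, 0)).val = (rowGenerator α φ : L) ^ j := fun j => by
    rw [rowGenerator, ← Units.val_pow_eq_pow_val, pow_val_nsmul hα hn, Units.val_pow_eq_pow_val]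
  simp only [infoSet, Set.mem_union, Set.mem_singleton_iff, Set.mem_ofPred_eq]
  refine or_congr_right ⟨?_, ?_⟩
  · rintro ⟨i, h1, h2, rfl⟩
    refine ⟨(φ i).1.val, h1, ?_⟩
    rw [← key]
    have h3 : (φ i).2 = 0 := (ZMod.val_eq_zero _).mp (by omega)
    have : (φ i).1.val • φ.symm (1, 0) = i := by
      rw [← map_nsmul, AddEquiv.symm_apply_eq]
      ext <;> simp [h3]
    rw [this]
  · rintro ⟨j, hj, rfl⟩
    refine ⟨j • φ.symm (1, 0), ?_, ?_, (key j).symm⟩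
    · rw [map_nsmul, AddEquiv.apply_symm_apply]
      simpa [ZMod.val_natCast, Nat.mod_eq_of_lt (hj.trans_le hm)] using hj
    · rw [map_nsmul, AddEquiv.apply_symm_apply]
      simp

variable {K : Type*} [Field K] [Fintype K] [Algebra K L] {q m : ℕ}
  (hK : Fintype.card K = q) (hL : Fintype.card L = q ^ m)
include hK

/-- The field generated by an element of order `r₁` has degree at least `Ord_{r₁}(q)`: if it has
`q ^ d` elements, then `r₁` divides `q ^ d - 1`. -/
lemma orderOf_le_natDegree_minpoly [NeZero n] :
    orderOf (q : ZMod r₁) ≤ (minpoly K (rowGenerator α φ : L)).natDegree := by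
  have hq : 1 < q := hK ▸ Fintype.one_lt_card
  have hint : IsIntegral K (rowGenerator α φ : L) := Algebra.IsIntegral.isIntegral _
  set β := rowGenerator α φ
  set d := (minpoly K (β : L)).natDegree
  -- `β` lies in a field with `q ^ d` elements
  have hpow : (β : L) ^ q ^ d = β := by
    have h1 : Fintype.card (IntermediateField.adjoin K {(β : L)}) = q ^ d := by
      rw [Module.card_eq_pow_finrank (K := K), hK, IntermediateField.adjoin.finrank hint]
    have h2 := FiniteField.pow_card (IntermediateField.AdjoinSimple.gen K (β : L))
    rw [h1] at h2
    simpa using congrArg Subtype.val h2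
  have hpos : 0 < q ^ d := by positivity
  have h3 : β ^ (q ^ d - 1) = 1 := by
    refine mul_right_cancel (b := β) ?_
    rw [← pow_succ, Nat.sub_add_cancel hpos, one_mul]
    exact Units.ext (by simpa using hpow)
  have h4 := dvd_of_rowGenerator_pow_eq_one hα hn φ h3
  rw [← Nat.modEq_iff_dvd' hpos, ← ZMod.natCast_eq_natCast_iff] at h4
  push_cast at h4
  exact Nat.le_of_dvd (minpoly.natDegree_pos hint) (orderOf_dvd_of_pow_eq_one h4.symm)

include hL

/-- The powers `β ^ j`, `j < m`, of an element of order `r₁` form a basis of `L` over `K`. -/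
lemma exists_basis_rowGenerator [NeZero n] (hm : 0 < m) (hord : orderOf (q : ZMod r₁) = m) :
    ∃ b : Module.Basis (Fin m) K L, ∀ j, b j = (rowGenerator α φ : L) ^ (j : ℕ) := by
  have hle := orderOf_le_natDegree_minpoly hα hn φ hK
  rw [hord] at hle
  have hli := (linearIndependent_pow (K := K) (rowGenerator α φ : L)).comp _
    (Fin.castLE_injective hle)
  have : Nonempty (Fin m) := ⟨⟨0, hm⟩⟩
  exact ⟨basisOfLinearIndependentOfCardEqFinrank hli
    (by rw [finrank_eq hK hL, Fintype.card_fin]), fun j => by simp⟩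

lemma exists_mem_grmCode_coeff_eq [NeZero n] [NeZero r₁] [NeZero r₂] (h6 : 2 < q ^ m)
    (hm : 0 < m) (hmr : m ≤ r₁) (hord : orderOf (q : ZMod r₁) = m) (y : infoSet m α φ → K) :
    ∃ c ∈ grmCode K L q m 1, ∀ i : infoSet m α φ, c.coeff i.1 = y i := by
  obtain ⟨b, hb⟩ := exists_basis_rowGenerator hα hn φ hK hL hm hord
  have h0 : (0 : L) ∈ infoSet m α φ := Or.inl rfl
  have hj : ∀ j : Fin m, (rowGenerator α φ : L) ^ (j : ℕ) ∈ infoSet m α φ := fun j =>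
    (mem_infoSet_iff hα hn φ hmr).mpr (Or.inr ⟨j, j.2, rfl⟩)
  refine ⟨affineWord (y ⟨0, h0⟩) (b.constr K fun j => y ⟨_, hj j⟩ - y ⟨0, h0⟩),
    (mem_grmCode_one_iff hK hL h6).mpr ⟨_, _, rfl⟩, ?_⟩
  rintro ⟨i, hi⟩
  rcases (mem_infoSet_iff hα hn φ hmr).mp hi with rfl | ⟨j, hjm, rfl⟩
  · simp
  · have := b.constr_basis K (fun j => y ⟨_, hj j⟩ - y ⟨0, h0⟩) ⟨j, hjm⟩
    rw [hb] at this
    rw [affineWord_coeff, this]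
    simp

lemma eq_zero_of_coeff_infoSet_eq_zero [NeZero n] [NeZero r₁] [NeZero r₂] (h6 : 2 < q ^ m)
    (hm : 0 < m) (hmr : m ≤ r₁) (hord : orderOf (q : ZMod r₁) = m) {c : Word K L}
    (hc : c ∈ grmCode K L q m 1) (h : ∀ i ∈ infoSet m α φ, c.coeff i = 0) : c = 0 := by
  obtain ⟨b, hb⟩ := exists_basis_rowGenerator hα hn φ hK hL hm hord
  obtain ⟨a, f, rfl⟩ := (mem_grmCode_one_iff hK hL h6).mp hc
  obtain rfl : a = 0 := by simpa using h 0 (Or.inl rfl)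
  have hf : f = 0 := b.ext fun j => by
    have := h _ ((mem_infoSet_iff hα hn φ hmr).mpr (Or.inr ⟨j, j.2, rfl⟩))
    rw [hb]
    simpa using this
  ext g
  simp [hf]

end Exponents

/-! ### PD-like sets -/

section PDLike

variable {L : Type*} [Field L] [Fintype L] {α : Lˣ} (hα : ∀ x : Lˣ, x ∈ Subgroup.zpowers α)
  {n : ℕ} (hn : n = Fintype.card L - 1)
  {r₁ r₂ : ℕ} (φ : ZMod n ≃+ ZMod r₁ × ZMod r₂)
include hα hn

/-- Fewer than `(l + 1) r₂` positions leave a row of `ZMod r₁ × ZMod r₂` with at most `l` of them;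
in this row each of them rules out `m` shifts, so `l m < r₁` leaves one that avoids `Γ`. -/
lemma exists_shift_avoiding_infoSet [NeZero n] [NeZero r₁] [NeZero r₂] {m l : ℕ} (hl : m * l < r₁)
    {B : Finset (GStar L)} (hB : B.card < (l + 1) * r₂) :
    ∃ a : Lˣ, ∀ b ∈ B, T a b ∉ prime (infoSet m α φ) := by
  choose ind hind using fun b : GStar L => exists_pow_val_eq hα hn (Units.mk0 b.1 b.2)
  obtain ⟨v, -, hv⟩ := Finset.exists_card_fiber_lt_of_card_lt_mul
    (s := B) (t := (univ : Finset (ZMod r₂))) (f := fun b => (φ (ind b)).2) (n := l + 1)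
    (by rwa [Finset.card_univ, ZMod.card, mul_comm])
  obtain ⟨u, hu⟩ : ∃ u : ZMod r₁, u ∉ (B.filter fun b => (φ (ind b)).2 = v).biUnion fun b =>
      (range m).image fun j : ℕ => (j : ZMod r₁) - (φ (ind b)).1 := by
    by_contra! h
    have h1 := Finset.card_biUnion_le_card_mul (B.filter fun b => (φ (ind b)).2 = v)
      (fun b => (range m).image fun j : ℕ => (j : ZMod r₁) - (φ (ind b)).1) m
      fun b _ => Finset.card_image_le.trans (card_range m).le
    rw [Finset.eq_univ_of_forall h, Finset.card_univ, ZMod.card] at h1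
    have h2 := Nat.mul_le_mul_right m (Nat.le_of_lt_succ hv)
    rw [mul_comm] at hl
    omega
  refine ⟨α ^ (φ.symm (u, -v)).val, fun b hb hmem => ?_⟩
  have hT : ((T (α ^ (φ.symm (u, -v)).val) b : GStar L) : L) =
      (α ^ (φ.symm (u, -v) + ind b).val : Lˣ) := by
    rw [pow_val_add hα hn, hind]
    rfl
  rcases hmem with h0 | ⟨i, hi1, hi2, hi⟩
  · exact (T (α ^ (φ.symm (u, -v)).val) b).2 h0
  · rw [hT, ← Units.val_pow_eq_pow_val] at hi
    obtain rfl := pow_val_injective hα hn (Units.ext hi)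
    rw [map_add, AddEquiv.apply_symm_apply] at hi1 hi2
    have h2 : -v + (φ (ind b)).2 = 0 := (ZMod.val_eq_zero _).mp (Nat.lt_one_iff.mp hi2)
    refine hu (Finset.mem_biUnion.mpr ⟨b, Finset.mem_filter.mpr ⟨hb, ?_⟩,
      Finset.mem_image.mpr ⟨(u + (φ (ind b)).1).val, Finset.mem_range.mpr hi1, ?_⟩⟩)
    · exact (neg_add_eq_zero.mp h2).symm
    · simp

lemma isPDLikeSet_zpowers_T [NeZero n] [NeZero r₁] [NeZero r₂] {K : Type*} [Field K]
    {C : Submodule K (Word K L)} (hC : ∀ a : Lˣ, ∀ c ∈ C, act (affinePerm a 0) c ∈ C)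
    {m l s : ℕ} (hl : m * l < r₁) (hs : s < (l + 1) * r₂) :
    IsPDLikeSet C (prime (infoSet m α φ)) s (Subgroup.zpowers (T α)) := by
  refine ⟨?_, fun B hB => ?_⟩
  · rintro _ ⟨k, rfl⟩
    simp only [T_zpow]
    exact mem_PAutStar_T hC _
  · obtain ⟨a, ha⟩ := exists_shift_avoiding_infoSet hα hn φ hl (hB ▸ hs)
    obtain ⟨k, rfl⟩ := hα a
    exact ⟨T (α ^ k), ⟨k, T_zpow α k⟩, ha⟩

end PDLike

/-- For integers `m < ⌈r / l⌉` means `m l < r`, so the greatest such `l` is `⌊(r - 1) / m⌋`. -/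
lemma isGreatest_lt_ceil_div {m r : ℕ} (hm : 0 < m) (hmr : m < r) :
    IsGreatest {l : ℕ | 0 < l ∧ m < ⌈(r : ℚ) / l⌉₊} ((r - 1) / m) ∧ m * ((r - 1) / m) < r := by
  have hiff : ∀ l : ℕ, 0 < l → (m < ⌈(r : ℚ) / l⌉₊ ↔ m * l < r) := fun l hl => by
    rw [Nat.lt_ceil, lt_div_iff₀ (by exact_mod_cast hl)]
    exact_mod_cast Iff.rfl
  have hlt : m * ((r - 1) / m) < r := by
    have := Nat.mul_div_le (r - 1) m
    omega
  have hpos : 0 < (r - 1) / m := Nat.div_pos (by omega) hm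
  refine ⟨⟨⟨hpos, (hiff _ hpos).mpr hlt⟩, ?_⟩, hlt⟩
  rintro l ⟨hl, h⟩
  rw [hiff l hl] at h
  rw [Nat.le_div_iff_mul_le hm, mul_comm]
  omega

lemma orderOf_zmod_lt {r q : ℕ} (hr : 1 < r) (h : 0 < orderOf (q : ZMod r)) :
    orderOf (q : ZMod r) < r := by
  have : NeZero r := ⟨by omega⟩
  obtain ⟨u, hu⟩ := (orderOf_pos_iff.mp h).isUnit
  rw [← hu, orderOf_units]
  refine orderOf_le_card_univ.trans_lt ?_
  rw [ZMod.card_units_eq_totient]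
  exact Nat.totient_lt r hr

end

end GRM

theorem mainTheorem1 {K L : Type*} [Field K] [Fintype K] [Field L] [Fintype L] [Algebra K L]
    (q m n r₁ r₂ : ℕ) (hK : Fintype.card K = q) (hL : Fintype.card L = q ^ m)
    (hn : n = q ^ m - 1) (hr : n = r₁ * r₂) (hcop : Nat.Coprime r₁ r₂)
    (hr₁ : 1 < r₁) (hr₂ : 1 < r₂)
    (α : Lˣ) (hα : ∀ x : Lˣ, x ∈ Subgroup.zpowers α)
    (φ : ZMod n ≃+ ZMod r₁ × ZMod r₂) :
    -- `R_q(1,m)` is the affine-invariant code with the prescribed defining set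
    (GRM.IsAffineInvariant α (GRM.grmCode K L q m 1) ∧
      GRM.definingSet (GRM.grmCode K L q m 1) = GRM.grmDefiningSet q m 1) ∧
    -- after interchanging the two factors if necessary, `Ord_{r₁}(q) = m`
    (orderOf (q : ZMod r₁) = m ∨ orderOf (q : ZMod r₂) = m) ∧
    (orderOf (q : ZMod r₁) = m →
      GRM.IsInformationSet (GRM.grmCode K L q m 1) (GRM.infoSet m α φ) ∧
      (∃ H, GRM.IsStandardParityCheck (GRM.grmCode K L q m 1) (GRM.infoSet m α φ) H) ∧
      ∃ l₀ : ℕ, IsGreatest {l : ℕ | 0 < l ∧ m < ⌈(r₁ : ℚ) / l⌉₊} l₀ ∧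
        GRM.IsPDLikeSet (GRM.grmCode K L q m 1) (GRM.prime (GRM.infoSet m α φ))
          ((l₀ + 1) * r₂ - 1) (Subgroup.zpowers (GRM.T α)) ∧
        ∀ s : ℕ, s = min ((l₀ + 1) * r₂ - 1) (GRM.capability (GRM.grmCode K L q m 1)) →
          GRM.IsPDLikeSet (GRM.grmCode K L q m 1) (GRM.prime (GRM.infoSet m α φ)) s
            (Subgroup.zpowers (GRM.T α)) ∧
          ∀ H, GRM.IsStandardParityCheck (GRM.grmCode K L q m 1) (GRM.infoSet m α φ) H →
            ∀ P : List (Equiv.Perm (GRM.GStar L)),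
              GRM.IsPDLikeSet (GRM.grmCode K L q m 1) (GRM.prime (GRM.infoSet m α φ)) s
                {τ | τ ∈ P} →
              GRM.CorrectsUpTo (GRM.grmCode K L q m 1) s
                (GRM.algorithmI n α H P (GRM.capability (GRM.grmCode K L q m 1)))) := by
  have h6 : 2 < q ^ m := by
    have := Nat.mul_le_mul hr₁ hr₂
    omega
  have hq : 1 < q := hK ▸ Fintype.one_lt_card
  have hm : 0 < m := Nat.pos_of_ne_zero (by rintro rfl; simp at h6)
  have hn' : n = Fintype.card L - 1 := by rw [hL, hn]
  refine ⟨⟨GRM.isAffineInvariant_grmCode hK hL h6 α, GRM.definingSet_grmCode_one hK hL h6⟩,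
    GRM.orderOf_eq_or_orderOf_eq hq hm (hn.symm.trans hr), fun hord => ?_⟩
  have : NeZero n := ⟨by omega⟩
  have : NeZero r₁ := ⟨by omega⟩
  have : NeZero r₂ := ⟨by omega⟩
  have hmr : m < r₁ := by
    rw [← hord]
    exact GRM.orderOf_zmod_lt hr₁ (by omega)
  have hsurj := GRM.exists_mem_grmCode_coeff_eq hα hn' φ hK hL h6 hm hmr.le hord
  have hinj : ∀ c ∈ GRM.grmCode K L q m 1, (∀ i ∈ GRM.infoSet m α φ, c.coeff i = 0) → c = 0 :=
    fun c => GRM.eq_zero_of_coeff_infoSet_eq_zero hα hn' φ hK hL h6 hm hmr.le hord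
  obtain ⟨hl, hlt⟩ := GRM.isGreatest_lt_ceil_div hm hmr
  have haff : ∀ (a : Lˣ) (b : L), ∀ c ∈ GRM.grmCode K L q m 1,
      GRM.act (GRM.affinePerm a b) c ∈ GRM.grmCode K L q m 1 :=
    fun a b c => GRM.act_affinePerm_mem hK hL h6 a b
  have hpos : 0 < ((r₁ - 1) / m + 1) * r₂ := Nat.mul_pos (Nat.succ_pos _) (by omega)
  refine ⟨GRM.isInformationSet_of_bijective hsurj hinj,
    GRM.exists_isStandardParityCheck hsurj hinj, (r₁ - 1) / m, hl,
    GRM.isPDLikeSet_zpowers_T hα hn' φ (fun a => haff a 0) hlt (by omega), ?_⟩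
  rintro s rfl
  refine ⟨GRM.isPDLikeSet_zpowers_T hα hn' φ (fun a => haff a 0) hlt (by omega),
    fun H hH P hP => ?_⟩
  refine GRM.correctsUpTo_algorithmI (fun c => GRM.sum_coeff_eq_zero hK h6) (fun b c hc => ?_) hα
    hn' hH (min_le_right _ _) hP
  have : Equiv.addRight b = GRM.affinePerm 1 b := by
    ext g
    simp [GRM.affinePerm]
  rw [this]
  exact haff 1 b c hc
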